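/- **Proposition 8.2** (pressure for the incompressible inviscid system). Let $T\in(0,\infty]$, let $\Omega(t)\subset\mathbb R^3$ be a bounded $C^2$-domain for each $t\in[0,T)$, and put $\Omega_T=\bigcup_{0<t<T}\Omega(t)\times\{t\}$. Let $\rho=\rho(x,t)\in\mathbb R$ and $v=v(x,t)\in\mathbb R^3$ be of class $C^1$ in a neighbourhood of each point of $\Omega_T$, and let $D_tv=\partial_tv+(v,\nabla)v=\partial_t v+\sum_{i=1}^3 v_i\,\partial_i v$. Fix $t\in(0,T)$. Assume that $$\int_{\Omega(t)}\rho(x,t)\,D_tv(x,t)\cdot z(x)\,dx=0$$ for every $z\in[C_0^\infty(\Omega(t))]^3$ (smooth, with compact support in $\Omega(t)$) satisfying $\operatorname{div}z=0$. Then there is a function $\sigma\in C^1(\Omega(t))$ such that $\rho(x,t)\,D_tv(x,t)=\nabla\sigma(x)$ for all $x\in\Omega(t)$. -/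

import Mathlib

open scoped ContDiff

namespace MovingFluid

/-- Three-dimensional Euclidean space. -/
abbrev Space : Type := EuclideanSpace ℝ (Fin 3)

/-- The partial derivative `∂ᵢ g` of a function of the space variable. -/
noncomputable def partialDeriv {F : Type*} [NormedAddCommGroup F] [NormedSpace ℝ F]
    (i : Fin 3) (g : Space → F) (x : Space) : F :=
  lineDeriv ℝ g x (EuclideanSpace.single i 1)

/-- The divergence `div z = ∂₁ z₁ + ∂₂ z₂ + ∂₃ z₃` of a vector field. -/
noncomputable def divergence (z : Space → Space) (x : Space) : ℝ :=
  ∑ i : Fin 3, partialDeriv i (fun y => z y i) x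

/-- The material derivative `D_t f = ∂_t f + v₁ ∂₁ f + v₂ ∂₂ f + v₃ ∂₃ f` of a (scalar or vector
valued) function `f = f (x, t)`, along the velocity `v = v (x, t)`. -/
noncomputable def materialDeriv {F : Type*} [NormedAddCommGroup F] [NormedSpace ℝ F]
    (v : Space × ℝ → Space) (f : Space × ℝ → F) (p : Space × ℝ) : F :=
  deriv (fun s : ℝ => f (p.1, s)) p.2 +
    ∑ i : Fin 3, v p i • partialDeriv i (fun y => f (y, p.2)) p.1

/-- A bounded `C²`-domain of `ℝ³`: a bounded, connected, nonempty open set which, near each of its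
boundary points, is the sublevel set `{φ < 0}` of a `C²` function `φ` with nonzero derivative
(that is, it lies locally on one side of a `C²` surface). -/
structure IsBoundedC2Domain (Ω : Set Space) : Prop where
  isOpen : IsOpen Ω
  isConnected : IsConnected Ω
  isBounded : Bornology.IsBounded Ω
  boundary : ∀ x ∈ frontier Ω, ∃ (U : Set Space) (φ : Space → ℝ), IsOpen U ∧ x ∈ U ∧
    ContDiffOn ℝ 2 φ U ∧ (∀ y ∈ U, fderiv ℝ φ y ≠ 0) ∧ Ω ∩ U = {y ∈ U | φ y < 0}

/-- The space-time domain `Ω_T`, the union of the slices `Ω(t) × {t}` with `0 < t < T`. -/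
def spaceTime (T : EReal) (Ω : ℝ → Set Space) : Set (Space × ℝ) :=
  {p | 0 < p.2 ∧ (p.2 : EReal) < T ∧ p.1 ∈ Ω p.2}

/-- `z ∈ [C₀^∞(Ω)]³`: smooth vector fields with compact support contained in `Ω`
(extended by zero to all of `ℝ³`). -/
structure IsTestField (Ω : Set Space) (z : Space → Space) : Prop where
  smooth : ContDiff ℝ ∞ z
  compactSupport : HasCompactSupport z
  tsupport_subset : tsupport z ⊆ Ω

end MovingFluid

/-! At the fixed time, F = ρ D_t v is a continuous field on a connected open set, so it has a C¹
potential once its line integrals along polygonal paths depend only on the endpoints. The unit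
current along a segment from a to b has distributional divergence δ_a − δ_b. Mollified, it is a
smooth field supported near the segment (`hasLineDerivAt_segmentAverage`), and its pairing with F
tends to the line integral (`tendsto_integral_mul_segmentAverage`). Along a polygonal path the point
masses telescope, so the mollified currents of two paths with the same endpoints differ by a
solenoidal test field. Orthogonality to it gives path independence in the limit
(`PolygonalIntegral.unique`). -/

namespace MovingFluid

open MeasureTheory Filter Topology Set Metric
open scoped Convolution

/-! ### Smoothed currents along a segment -/

section Mollifier

variable {E : Type*} [NormedAddCommGroup E] [NormedSpace ℝ E]

/-- The average of the translates of `η` along the segment from `a` to `b`. -/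
noncomputable def segmentAverage (η : E → ℝ) (a b x : E) : ℝ :=
  ∫ s in (0 : ℝ)..1, η (x - (a + s • (b - a)))

theorem add_smul_sub_mem_segment (a b : E) {s : ℝ} (hs : s ∈ Icc (0 : ℝ) 1) :
    a + s • (b - a) ∈ segment ℝ a b := by
  rw [segment_eq_image']
  exact ⟨s, hs, rfl⟩

theorem isCompact_segment (a b : E) : IsCompact (segment ℝ a b) := by
  rw [segment_eq_image']
  exact isCompact_Icc.image (by fun_prop)

theorem segmentAverage_eq_zero {η : E → ℝ} {a b x : E} {r : ℝ}
    (hη : ∀ y, r ≤ ‖y‖ → η y = 0) (hx : x ∉ cthickening r (segment ℝ a b)) :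
    segmentAverage η a b x = 0 := by
  rw [segmentAverage, intervalIntegral.integral_of_le zero_le_one]
  refine setIntegral_eq_zero_of_forall_eq_zero fun s hs => hη _ ?_
  by_contra! h
  refine hx (mem_cthickening_of_dist_le x _ r _
    (add_smul_sub_mem_segment a b (Ioc_subset_Icc_self hs)) ?_)
  rw [dist_eq_norm]
  exact h.le

/-- The average is a convolution of η with the image on the segment of Lebesgue measure on (0, 1],
so it inherits the smoothness of η. -/
theorem contDiff_segmentAverage [MeasurableSpace E] [BorelSpace E] [SecondCountableTopology E]
    {η : E → ℝ} (hη : ContDiff ℝ ∞ η)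
    (hc : HasCompactSupport η) (a b : E) : ContDiff ℝ ∞ (segmentAverage η a b) := by
  have hγ : Continuous fun s : ℝ => a + s • (b - a) := by fun_prop
  let μ : Measure E := (volume.restrict (Ioc (0 : ℝ) 1)).map fun s : ℝ => a + s • (b - a)
  have : IsFiniteMeasure μ := by infer_instance
  have key : segmentAverage η a b =
      (fun _ : E => (1 : ℝ)) ⋆[ContinuousLinearMap.lsmul ℝ ℝ, μ] η := by
    ext x
    have hm : AEStronglyMeasurable (fun t => η (x - t)) μ :=
      (hη.continuous.comp (by fun_prop : Continuous fun t => x - t)).aestronglyMeasurable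
    simp only [convolution_def, ContinuousLinearMap.lsmul_apply, one_smul]
    rw [integral_map hγ.aemeasurable hm, segmentAverage,
      intervalIntegral.integral_of_le zero_le_one]
  rw [key]
  exact hc.contDiff_convolution_right (n := ⊤) _ (locallyIntegrable_const 1) hη

/-- Moving x by h (b − a) only shifts the parameter interval to [−h, 1 − h], so the fundamental
theorem of calculus leaves the two endpoint values. -/
theorem hasLineDerivAt_segmentAverage {η : E → ℝ} (hη : Continuous η) (a b x : E) :
    HasLineDerivAt ℝ (segmentAverage η a b) (η (x - a) - η (x - b)) x (b - a) := by
  have hg : Continuous fun s : ℝ => η (x - (a + s • (b - a))) := by fun_prop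
  have h1 : ∀ h : ℝ, segmentAverage η a b (x + h • (b - a)) =
      ∫ s in (-h)..(1 - h), η (x - (a + s • (b - a))) := by
    intro h
    rw [segmentAverage, ← zero_sub h,
      ← intervalIntegral.integral_comp_sub_right (fun s => η (x - (a + s • (b - a))))]
    congr 1
    ext s
    congr 1
    module
  have h2 : ∀ h : ℝ, segmentAverage η a b (x + h • (b - a)) =
      (∫ s in (0 : ℝ)..(1 - h), η (x - (a + s • (b - a)))) -
        ∫ s in (0 : ℝ)..(-h), η (x - (a + s • (b - a))) := by
    intro h
    rw [h1, intervalIntegral.integral_interval_sub_left] <;> exact hg.intervalIntegrable _ _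
  have hI : ∀ u : ℝ, HasDerivAt (fun r => ∫ s in (0 : ℝ)..r, η (x - (a + s • (b - a))))
      (η (x - (a + u • (b - a)))) u := fun u => hg.integral_hasStrictDerivAt 0 u |>.hasDerivAt
  rw [HasLineDerivAt, funext h2]
  have e1 := (hI (1 - 0)).comp (0 : ℝ) ((hasDerivAt_id (0 : ℝ)).const_sub 1)
  have e2 := (hI (-0)).comp (0 : ℝ) ((hasDerivAt_id (0 : ℝ)).neg)
  refine (e1.sub e2).congr_deriv ?_
  simp
  ring

end Mollifier

/-! ### Convergence of mollified currents to line integrals -/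

section MollifierSequence

variable (E : Type*) [NormedAddCommGroup E] [InnerProductSpace ℝ E] [FiniteDimensional ℝ E]

/-- A bump function at the origin, supported in the ball of radius `1 / (n + 1)`. -/
noncomputable def bump (n : ℕ) : ContDiffBump (0 : E) where
  rIn := 1 / (n + 1) / 2
  rOut := 1 / (n + 1)
  rIn_pos := by positivity
  rIn_lt_rOut := half_lt_self (by positivity)

variable [MeasurableSpace E] [BorelSpace E]

/-- The mollifiers obtained by normalizing `bump`. -/
noncomputable def mollifier (n : ℕ) : E → ℝ := (bump E n).normed volume

variable {E}

theorem contDiff_mollifier (n : ℕ) : ContDiff ℝ ∞ (mollifier E n) :=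
  (bump E n).contDiff_normed (n := ⊤)

theorem hasCompactSupport_mollifier (n : ℕ) : HasCompactSupport (mollifier E n) :=
  (bump E n).hasCompactSupport_normed

theorem mollifier_eq_zero {n : ℕ} {r : ℝ} (hr : 1 / ((n : ℝ) + 1) ≤ r) {y : E} (hy : r ≤ ‖y‖) :
    mollifier E n y = 0 := by
  by_contra h
  have : y ∈ Function.support (mollifier E n) := h
  rw [mollifier, (bump E n).support_normed_eq, mem_ball_zero_iff] at this
  exact absurd (hr.trans hy) (not_le.2 this)

/-- Fubini for the segment averages of a mollifier. -/
theorem integral_mul_segmentAverage {h : E → ℝ} (hh : Integrable h) (n : ℕ) (a b : E) :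
    ∫ x, h x * segmentAverage (mollifier E n) a b x =
      ∫ s in (0 : ℝ)..1,
        (mollifier E n ⋆[ContinuousLinearMap.lsmul ℝ ℝ, volume] h) (a + s • (b - a)) := by
  have hc : Continuous (mollifier E n) := (contDiff_mollifier n).continuous
  obtain ⟨C, hC⟩ := (hasCompactSupport_mollifier (E := E) n).exists_bound_of_continuous hc
  simp only [segmentAverage, intervalIntegral.integral_of_le zero_le_one]
  simp_rw [← integral_const_mul]
  rw [integral_integral_swap]
  · refine integral_congr_ae (ae_of_all _ fun s => ?_)
    simp only [convolution_eq_swap, ContinuousLinearMap.lsmul_apply, smul_eq_mul]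
    refine integral_congr_ae (ae_of_all _ fun x => ?_)
    simp only
    rw [mul_comm, mollifier, ← (bump E n).normed_neg, neg_sub]
  · have h1 : Integrable (fun p : E × ℝ => h p.1)
        (volume.prod (volume.restrict (Ioc (0 : ℝ) 1))) := hh.comp_fst _
    refine h1.mul_bdd (c := C) ?_ (ae_of_all _ fun p => hC _)
    exact (Continuous.aestronglyMeasurable (by fun_prop))

theorem tendsto_integral_mul_segmentAverage {Ω : Set E} (hΩ : IsOpen Ω) {g : E → ℝ}
    (hg : ContinuousOn g Ω) {a b : E} (hab : segment ℝ a b ⊆ Ω) :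
    Tendsto (fun n => ∫ x in Ω, g x * segmentAverage (mollifier E n) a b x) atTop
      (𝓝 (∫ s in (0 : ℝ)..1, g (a + s • (b - a)))) := by
  obtain ⟨δ, hδ, hδΩ⟩ := (isCompact_segment a b).exists_cthickening_subset_open hΩ hab
  set K := cthickening δ (segment ℝ a b) with hKdef
  have hK : IsCompact K := (isCompact_segment a b).cthickening
  have hgK : ContinuousOn g K := hg.mono hδΩ
  -- Cutting off outside K makes g integrable on the whole space, and costs nothing once the
  -- mollified segment is supported in K.
  set h : E → ℝ := K.indicator g with hhdef
  have hh : Integrable h := (integrable_indicator_iff hK.measurableSet).2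
    (hgK.integrableOn_compact hK)
  have hγ : Continuous fun s : ℝ => a + s • (b - a) := by fun_prop
  have huc := hK.uniformContinuousOn_of_continuous hgK
  rw [Metric.uniformContinuousOn_iff] at huc
  rw [Metric.tendsto_atTop]
  intro ε hε
  obtain ⟨r, hr, hur⟩ := huc (ε / 2) (half_pos hε)
  -- r controls the oscillation of g on K; δ keeps the mollifier's balls around the segment inside
  -- K.
  obtain ⟨N, hN⟩ := exists_nat_one_div_lt (lt_min hr hδ)
  refine ⟨N, fun n hn => ?_⟩
  have hn' : 1 / ((n : ℝ) + 1) < min r δ := by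
    refine lt_of_le_of_lt ?_ hN
    gcongr
  have e1 : ∫ x in Ω, g x * segmentAverage (mollifier E n) a b x =
      ∫ x, h x * segmentAverage (mollifier E n) a b x := by
    rw [← integral_indicator hΩ.measurableSet]
    congr 1
    ext x
    by_cases hx : x ∈ K
    · rw [indicator_of_mem (hδΩ hx), hhdef, indicator_of_mem hx]
    · have : segmentAverage (mollifier E n) a b x = 0 :=
        segmentAverage_eq_zero (fun y hy =>
          mollifier_eq_zero (hn'.le.trans (min_le_right _ _)) hy) hx
      simp [this]
  have hmem : ∀ s ∈ Icc (0 : ℝ) 1, a + s • (b - a) ∈ K := fun s hs =>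
    self_subset_cthickening _ (add_smul_sub_mem_segment a b hs)
  have e2 : ∫ s in (0 : ℝ)..1, g (a + s • (b - a)) = ∫ s in (0 : ℝ)..1, h (a + s • (b - a)) := by
    refine intervalIntegral.integral_congr fun s hs => ?_
    rw [uIcc_of_le zero_le_one] at hs
    simp only [hhdef, indicator_of_mem (hmem s hs)]
  have hconv : Continuous (mollifier E n ⋆[ContinuousLinearMap.lsmul ℝ ℝ, volume] h) :=
    (hasCompactSupport_mollifier n).continuous_convolution_left _
      (contDiff_mollifier n).continuous hh.locallyIntegrable
  have hgi : IntervalIntegrable (fun s => h (a + s • (b - a))) volume 0 1 := by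
    refine ContinuousOn.intervalIntegrable ?_
    rw [uIcc_of_le zero_le_one]
    refine (hgK.comp hγ.continuousOn hmem).congr fun s hs => ?_
    simp only [hhdef, indicator_of_mem (hmem s hs), Function.comp]
  have hci : IntervalIntegrable (fun s =>
      (mollifier E n ⋆[ContinuousLinearMap.lsmul ℝ ℝ, volume] h) (a + s • (b - a))) volume 0 1 :=
    (hconv.comp hγ).intervalIntegrable _ _
  rw [e1, e2, integral_mul_segmentAverage hh, dist_eq_norm,
    ← intervalIntegral.integral_sub hci hgi]
  refine lt_of_le_of_lt (intervalIntegral.norm_integral_le_of_norm_le_const (C := ε / 2) ?_)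
    (by rw [sub_zero, abs_one, mul_one]; exact half_lt_self hε)
  intro s hs
  rw [uIoc_of_le zero_le_one] at hs
  have hs' := Ioc_subset_Icc_self hs
  rw [← dist_eq_norm]
  refine (bump E n).dist_normed_convolution_le hh.aestronglyMeasurable fun x hx => ?_
  have hxr : dist x (a + s • (b - a)) < min r δ := (mem_ball.1 hx).trans hn'
  have hxK : x ∈ K := mem_cthickening_of_dist_le _ _ _ _
    (add_smul_sub_mem_segment a b hs') (hxr.le.trans (min_le_right _ _))
  simp only [hhdef, indicator_of_mem (hmem s hs'), indicator_of_mem hxK]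
  exact (hur x hxK _ (hmem s hs') (hxr.trans_le (min_le_left _ _))).le

end MollifierSequence

/-! ### Divergence and test fields -/

section TestFields

theorem divergence_eq_sum_fderiv {z : Space → Space} {x : Space} (hz : DifferentiableAt ℝ z x) :
    divergence z x = ∑ i : Fin 3, fderiv ℝ z x (EuclideanSpace.single i 1) i := by
  refine Finset.sum_congr rfl fun i _ => ?_
  have h : HasFDerivAt (fun y => z y i) ((EuclideanSpace.proj i : Space →L[ℝ] ℝ) ∘L fderiv ℝ z x) x :=
    (EuclideanSpace.proj i : Space →L[ℝ] ℝ).hasFDerivAt.comp x hz.hasFDerivAt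
  exact (h.hasLineDerivAt _).lineDeriv

theorem divergence_add {z w : Space → Space} {x : Space} (hz : DifferentiableAt ℝ z x)
    (hw : DifferentiableAt ℝ w x) :
    divergence (fun y => z y + w y) x = divergence z x + divergence w x := by
  rw [divergence_eq_sum_fderiv hz, divergence_eq_sum_fderiv hw,
    divergence_eq_sum_fderiv (hz.fun_add hw), fderiv_fun_add hz hw, ← Finset.sum_add_distrib]
  rfl

theorem divergence_sub {z w : Space → Space} {x : Space} (hz : DifferentiableAt ℝ z x)
    (hw : DifferentiableAt ℝ w x) :
    divergence (fun y => z y - w y) x = divergence z x - divergence w x := by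
  rw [divergence_eq_sum_fderiv hz, divergence_eq_sum_fderiv hw,
    divergence_eq_sum_fderiv (hz.fun_sub hw), fderiv_fun_sub hz hw, ← Finset.sum_sub_distrib]
  rfl

theorem divergence_smul_const {u : Space → ℝ} {x : Space} (hu : DifferentiableAt ℝ u x)
    (w : Space) : divergence (fun y => u y • w) x = fderiv ℝ u x w := by
  rw [divergence_eq_sum_fderiv (hu.smul_const w), (hu.hasFDerivAt.smul_const w).fderiv]
  have hw : w = ∑ i : Fin 3, w i • EuclideanSpace.single i (1 : ℝ) := by
    ext j
    simp [Pi.single_apply]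
  conv_rhs => rw [hw, map_sum]
  refine Finset.sum_congr rfl fun i _ => ?_
  simp [mul_comm]

theorem IsTestField.integrableOn {Ω : Set Space} {z F : Space → Space} (hz : IsTestField Ω z)
    (hF : ContinuousOn F Ω) : IntegrableOn (fun x => inner ℝ (F x) (z x)) Ω := by
  have h1 : IntegrableOn (fun x => inner ℝ (F x) (z x)) (tsupport z) :=
    ((hF.mono hz.tsupport_subset).inner hz.smooth.continuous.continuousOn).integrableOn_compact
      hz.compactSupport
  refine ((integrableOn_iff_integrable_of_support_subset fun x hx => ?_).1 h1).integrableOn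
  by_contra h
  exact hx (by simp only [image_eq_zero_of_notMem_tsupport h, inner_zero_right])

theorem IsTestField.add {Ω : Set Space} {z w : Space → Space} (hz : IsTestField Ω z)
    (hw : IsTestField Ω w) : IsTestField Ω (fun x => z x + w x) where
  smooth := hz.smooth.add hw.smooth
  compactSupport := hz.compactSupport.add hw.compactSupport
  tsupport_subset := (tsupport_add z w).trans (union_subset hz.tsupport_subset hw.tsupport_subset)

theorem IsTestField.sub {Ω : Set Space} {z w : Space → Space} (hz : IsTestField Ω z)
    (hw : IsTestField Ω w) : IsTestField Ω (fun x => z x - w x) where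
  smooth := hz.smooth.sub hw.smooth
  compactSupport := hz.compactSupport.sub hw.compactSupport
  tsupport_subset := (tsupport_sub z w).trans (union_subset hz.tsupport_subset hw.tsupport_subset)

/-- The mollified unit mass moving from `a` to `b` is eventually a test field. -/
theorem eventually_isTestField_segmentAverage {Ω : Set Space} (hΩ : IsOpen Ω) {a b : Space}
    (hab : segment ℝ a b ⊆ Ω) : ∀ᶠ n in atTop,
      IsTestField Ω fun x => segmentAverage (mollifier Space n) a b x • (b - a) := by
  obtain ⟨δ, hδ, hδΩ⟩ := (isCompact_segment a b).exists_cthickening_subset_open hΩ hab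
  have hK : IsCompact (cthickening δ (segment ℝ a b)) := (isCompact_segment a b).cthickening
  have hlim : ∀ᶠ n : ℕ in atTop, 1 / ((n : ℝ) + 1) < δ :=
    tendsto_one_div_add_atTop_nhds_zero_nat.eventually_lt_const hδ
  filter_upwards [hlim] with n hn
  have hsub : tsupport (fun x => segmentAverage (mollifier Space n) a b x • (b - a)) ⊆
      cthickening δ (segment ℝ a b) := by
    refine closure_minimal (fun x hx => ?_) isClosed_cthickening
    by_contra h
    refine hx ?_
    simp only [segmentAverage_eq_zero (fun y hy => mollifier_eq_zero hn.le hy) h, zero_smul]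
  exact ⟨(contDiff_segmentAverage (contDiff_mollifier n) (hasCompactSupport_mollifier n)
    a b).smul contDiff_const, hK.of_isClosed_subset (isClosed_tsupport _) hsub, hsub.trans hδΩ⟩

theorem divergence_segmentAverage (n : ℕ) (a b x : Space) :
    divergence (fun x => segmentAverage (mollifier Space n) a b x • (b - a)) x =
      mollifier Space n (x - a) - mollifier Space n (x - b) := by
  have hd : DifferentiableAt ℝ (segmentAverage (mollifier Space n) a b) x :=
    (contDiff_segmentAverage (contDiff_mollifier n) (hasCompactSupport_mollifier n)
      a b).differentiable (by simp) x
  rw [divergence_smul_const hd, ← hd.lineDeriv_eq_fderiv]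
  exact (hasLineDerivAt_segmentAverage (contDiff_mollifier n).continuous a b x).lineDeriv

end TestFields

/-! ### Path independence and the potential -/

section LineIntegrals

/-- The line integral of `F` along the segment from `a` to `b`. -/
noncomputable def segmentIntegral (F : Space → Space) (a b : Space) : ℝ :=
  ∫ s in (0 : ℝ)..1, inner ℝ (F (a + s • (b - a))) (b - a)

/-- `PolygonalIntegral F Ω x y c`: some polygonal path in `Ω` from `x` to `y` has line integral `c`
of `F` along it. -/
inductive PolygonalIntegral (F : Space → Space) (Ω : Set Space) (x : Space) : Space → ℝ → Prop
  | refl : PolygonalIntegral F Ω x x 0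
  | step {y z : Space} {c : ℝ} : PolygonalIntegral F Ω x y c → segment ℝ y z ⊆ Ω →
      PolygonalIntegral F Ω x z (c + segmentIntegral F y z)

variable {F : Space → Space} {Ω : Set Space}

/-- Mollification of a polygonal path. -/
theorem PolygonalIntegral.exists_testFields (hΩ : IsOpen Ω) (hF : ContinuousOn F Ω)
    {x y : Space} {c : ℝ} (h : PolygonalIntegral F Ω x y c) :
    ∃ z : ℕ → Space → Space, (∀ᶠ n in atTop, IsTestField Ω (z n) ∧ ∀ p, divergence (z n) p =
        mollifier Space n (p - x) - mollifier Space n (p - y)) ∧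
      Tendsto (fun n => ∫ p in Ω, inner ℝ (F p) (z n p)) atTop (𝓝 c) := by
  induction h with
  | refl =>
    refine ⟨fun _ _ => 0, Eventually.of_forall fun n => ⟨⟨contDiff_const, HasCompactSupport.zero,
      by simp [tsupport]⟩, fun p => ?_⟩, by simp⟩
    rw [divergence_eq_sum_fderiv (by fun_prop)]
    simp
  | @step y q c _ hseg ih =>
    obtain ⟨z, hz, hlim⟩ := ih
    have hw := eventually_isTestField_segmentAverage hΩ hseg
    have hwlim := tendsto_integral_mul_segmentAverage hΩ
      (hF.inner (continuousOn_const (c := q - y)) : ContinuousOn (fun p => inner ℝ (F p) (q - y)) Ω)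
      hseg
    refine ⟨fun n p => z n p + segmentAverage (mollifier Space n) y q p • (q - y), ?_, ?_⟩
    · filter_upwards [hz, hw] with n hzn hwn
      refine ⟨hzn.1.add hwn, fun p => ?_⟩
      -- The mollified masses at the intermediate vertex y cancel.
      rw [divergence_add (hzn.1.smooth.differentiable (by simp) p)
        (hwn.smooth.differentiable (by simp) p), hzn.2, divergence_segmentAverage]
      ring
    · refine (hlim.add hwlim).congr' ?_
      filter_upwards [hz, hw] with n hzn hwn
      rw [← integral_add (hzn.1.integrableOn hF)]
      · simp only [inner_add_right, inner_smul_right, mul_comm]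
      · refine (hwn.integrableOn hF).congr (ae_of_all _ fun p => ?_)
        simp only [inner_smul_right, mul_comm]

/-- If `F` is orthogonal to the solenoidal test fields, its line integrals are path independent. -/
theorem PolygonalIntegral.unique (hΩ : IsOpen Ω) (hF : ContinuousOn F Ω)
    (horth : ∀ z : Space → Space, IsTestField Ω z → (∀ x, divergence z x = 0) →
      ∫ x in Ω, inner ℝ (F x) (z x) = 0)
    {x y : Space} {c d : ℝ} (hc : PolygonalIntegral F Ω x y c)
    (hd : PolygonalIntegral F Ω x y d) : c = d := by
  obtain ⟨z, hz, hzl⟩ := hc.exists_testFields hΩ hF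
  obtain ⟨w, hw, hwl⟩ := hd.exists_testFields hΩ hF
  refine sub_eq_zero.1 (tendsto_nhds_unique (hzl.sub hwl) (tendsto_const_nhds.congr' ?_))
  filter_upwards [hz, hw] with n hzn hwn
  have h0 := horth _ (hzn.1.sub hwn.1) fun p => by
    rw [divergence_sub (hzn.1.smooth.differentiable (by simp) p)
        (hwn.1.smooth.differentiable (by simp) p), hzn.2, hwn.2, sub_self]
  rw [← integral_sub (hzn.1.integrableOn hF) (hwn.1.integrableOn hF), ← h0]
  simp only [inner_sub_right]

/-- In a connected open set any two points are joined by a polygonal path. -/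
theorem exists_polygonalIntegral (hΩ : IsOpen Ω) (hc : IsPreconnected Ω) {x : Space} (hx : x ∈ Ω)
    {y : Space} (hy : y ∈ Ω) : ∃ c, PolygonalIntegral F Ω x y c := by
  have hball : ∀ p ∈ Ω, ∃ r > 0, ball p r ⊆ Ω := Metric.isOpen_iff.1 hΩ
  have hseg : ∀ {p q r}, ball p r ⊆ Ω → q ∈ ball p r → 0 < r → segment ℝ p q ⊆ Ω :=
    fun h hq hr => ((convex_ball _ _).segment_subset (mem_ball_self hr) hq).trans h
  let S : Set Space := {p | p ∈ Ω ∧ ∃ c, PolygonalIntegral F Ω x p c}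
  have hS : IsOpen S := by
    refine Metric.isOpen_iff.2 fun p ⟨hp, c, hpc⟩ => ?_
    obtain ⟨r, hr, hb⟩ := hball p hp
    exact ⟨r, hr, fun q hq => ⟨hb hq, _, hpc.step (hseg hb hq hr)⟩⟩
  -- The set of reachable points is also closed in Ω: a limit point is joined by a segment to a
  -- reachable point nearby.
  refine (hc.subset_of_closure_inter_subset hS ⟨x, hx, hx, 0, .refl⟩ ?_ hy).2
  rintro p ⟨hpS, hp⟩
  obtain ⟨r, hr, hb⟩ := hball p hp
  obtain ⟨q, ⟨_, c, hq⟩, hpq⟩ := Metric.mem_closure_iff.1 hpS r hr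
  refine ⟨hp, _, hq.step ?_⟩
  rw [segment_symm]
  exact hseg hb (mem_ball'.2 hpq) hr

/-- Near x, F differs from F x by less than ε, so the line integral differs from ⟨F x, y − x⟩ by at
most ε ‖y − x‖. -/
theorem hasGradientAt_of_sub_eq_segmentIntegral (hΩ : IsOpen Ω) (hF : ContinuousOn F Ω)
    {σ : Space → ℝ} {x : Space} (hx : x ∈ Ω)
    (hσ : ∀ y, segment ℝ x y ⊆ Ω → σ y - σ x = segmentIntegral F x y) :
    HasGradientAt σ (F x) x := by
  rw [hasGradientAt_iff_hasFDerivAt, hasFDerivAt_iff_isLittleO, Asymptotics.isLittleO_iff]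
  intro ε hε
  obtain ⟨r, hr, hb⟩ := Metric.isOpen_iff.1 hΩ x hx
  obtain ⟨δ, hδ, hFδ⟩ := Metric.continuousAt_iff.1 (hF.continuousAt (hΩ.mem_nhds hx)) ε hε
  filter_upwards [ball_mem_nhds x (lt_min hr hδ)] with y hy
  have hsb : segment ℝ x y ⊆ ball x (min r δ) :=
    (convex_ball _ _).segment_subset (mem_ball_self (lt_min hr hδ)) hy
  have hsΩ : segment ℝ x y ⊆ Ω := hsb.trans ((ball_subset_ball (min_le_left _ _)).trans hb)
  have hint : IntervalIntegrable (fun s : ℝ => inner ℝ (F (x + s • (y - x))) (y - x))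
      volume 0 1 := by
    refine ContinuousOn.intervalIntegrable ?_
    rw [uIcc_of_le zero_le_one]
    exact (hF.comp (by fun_prop) fun s hs => hsΩ (add_smul_sub_mem_segment x y hs)).inner
      continuousOn_const
  have hcst : (InnerProductSpace.toDual ℝ Space (F x)) (y - x) =
      ∫ _ in (0 : ℝ)..1, inner ℝ (F x) (y - x) := by simp
  rw [hσ y hsΩ, hcst, segmentIntegral,
    ← intervalIntegral.integral_sub hint intervalIntegrable_const]
  have := intervalIntegral.norm_integral_le_of_norm_le_const (a := (0 : ℝ)) (b := 1)
    (C := ε * ‖y - x‖)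
    (f := fun s : ℝ => inner ℝ (F (x + s • (y - x))) (y - x) - inner ℝ (F x) (y - x)) ?_
  · simpa using this
  intro s hs
  rw [uIoc_of_le zero_le_one] at hs
  rw [← inner_sub_left]
  refine (norm_inner_le_norm _ _).trans ?_
  gcongr
  rw [← dist_eq_norm]
  exact (hFδ (lt_of_lt_of_le (hsb (add_smul_sub_mem_segment x y (Ioc_subset_Icc_self hs)))
    (min_le_right _ _))).le

/-- A continuous field on a connected open set which is orthogonal to all solenoidal test fields
is the gradient of a `C¹` function. -/
theorem exists_potential (hΩ : IsOpen Ω) (hc : IsConnected Ω) (hF : ContinuousOn F Ω)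
    (horth : ∀ z : Space → Space, IsTestField Ω z → (∀ x, divergence z x = 0) →
      ∫ x in Ω, inner ℝ (F x) (z x) = 0) :
    ∃ σ : Space → ℝ, ContDiffOn ℝ 1 σ Ω ∧ ∀ x ∈ Ω, HasGradientAt σ (F x) x := by
  classical
  obtain ⟨x₀, hx₀⟩ := hc.nonempty
  have hex : ∀ y, ∃ c, y ∈ Ω → PolygonalIntegral F Ω x₀ y c := fun y => by
    by_cases hy : y ∈ Ω
    · obtain ⟨c, h⟩ := exists_polygonalIntegral (F := F) hΩ hc.isPreconnected hx₀ hy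
      exact ⟨c, fun _ => h⟩
    · exact ⟨0, fun h => absurd h hy⟩
  choose σ hσ using hex
  have hgrad : ∀ x ∈ Ω, HasGradientAt σ (F x) x := fun x hx =>
    hasGradientAt_of_sub_eq_segmentIntegral hΩ hF hx fun y hy => by
      -- The path chosen for y and the path chosen for x prolonged by the segment from x to y have
      -- equal line integrals.
      rw [(hσ y (hy (right_mem_segment ℝ x y))).unique hΩ hF horth ((hσ x hx).step hy)]
      ring
  refine ⟨σ, ?_, hgrad⟩
  rw [show (1 : WithTop ℕ∞) = 0 + 1 from rfl, contDiffOn_succ_iff_fderiv_of_isOpen hΩ]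
  refine ⟨fun x hx => (hgrad x hx).differentiableAt.differentiableWithinAt, by simp, ?_⟩
  rw [contDiffOn_zero]
  exact ((InnerProductSpace.toDual ℝ Space).continuous.comp_continuousOn hF).congr fun x hx =>
    (hgrad x hx).hasFDerivAt.fderiv

end LineIntegrals

/-! ### Continuity of the material derivative -/

/-- The material derivative is the space-time derivative in the direction
`(v, 1)`. -/
theorem materialDeriv_eq_fderiv {F : Type*} [NormedAddCommGroup F] [NormedSpace ℝ F]
    {v : Space × ℝ → Space} {f : Space × ℝ → F} {p : Space × ℝ} (hf : DifferentiableAt ℝ f p) :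
    materialDeriv v f p = fderiv ℝ f p (v p, 1) := by
  have h1 : HasDerivAt (fun s : ℝ => f (p.1, s)) (fderiv ℝ f p (0, 1)) p.2 :=
    hf.hasFDerivAt.comp_hasDerivAt p.2 ((hasDerivAt_const p.2 p.1).prodMk (hasDerivAt_id p.2))
  have h2 : HasFDerivAt (fun y => f (y, p.2))
      (fderiv ℝ f p ∘L ContinuousLinearMap.inl ℝ Space ℝ) p.1 :=
    HasFDerivAt.comp (f := fun y : Space => (y, p.2)) p.1 hf.hasFDerivAt
      (hasFDerivAt_prodMk_left p.1 p.2)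
  have h3 : ∀ i, partialDeriv i (fun y => f (y, p.2)) p.1 =
      fderiv ℝ f p (EuclideanSpace.single i 1, 0) := fun i => (h2.hasLineDerivAt _).lineDeriv
  have hw : (v p, (1 : ℝ)) = (0, 1) +
      ∑ i : Fin 3, v p i • ((EuclideanSpace.single i 1 : Space), (0 : ℝ)) := by
    refine Prod.ext ?_ (by simp [Prod.snd_sum])
    ext j
    simp [Prod.fst_sum, Pi.single_apply]
  rw [materialDeriv, h1.deriv, hw, map_add, map_sum]
  simp only [h3, map_smul]

theorem continuousAt_materialDeriv {F : Type*} [NormedAddCommGroup F] [NormedSpace ℝ F]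
    {v : Space × ℝ → Space} {f : Space × ℝ → F} {p : Space × ℝ} (hv : ContinuousAt v p)
    (hf : ContDiffAt ℝ 1 f p) : ContinuousAt (materialDeriv v f) p := by
  have h : ContinuousAt (fun q => fderiv ℝ f q (v q, 1)) p :=
    (hf.continuousAt_fderiv one_ne_zero).clm_apply (hv.prodMk continuousAt_const)
  refine h.congr ?_
  -- Being C¹ at p is an open condition, so the formula in terms of `fderiv` holds near p.
  filter_upwards [hf.eventually (by simp)] with q hq
  exact (materialDeriv_eq_fderiv (hq.differentiableAt one_ne_zero)).symm

end MovingFluid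

theorem proposition8p2
    (T : EReal) (hT : 0 < T)
    -- the moving domain, a bounded C²-domain at each time of [0, T)
    (Ω : ℝ → Set MovingFluid.Space)
    (hΩ : ∀ s : ℝ, 0 ≤ s → (s : EReal) < T → MovingFluid.IsBoundedC2Domain (Ω s))
    -- the density and the velocity, of class C¹ around each point of the space-time domain
    (ρ : MovingFluid.Space × ℝ → ℝ) (v : MovingFluid.Space × ℝ → MovingFluid.Space)
    (hρ : ∀ p ∈ MovingFluid.spaceTime T Ω, ContDiffAt ℝ 1 ρ p)
    (hv : ∀ p ∈ MovingFluid.spaceTime T Ω, ContDiffAt ℝ 1 v p)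
    (t : ℝ) (ht0 : 0 < t) (htT : (t : EReal) < T)
    (horth : ∀ z : MovingFluid.Space → MovingFluid.Space,
      MovingFluid.IsTestField (Ω t) z → (∀ x, MovingFluid.divergence z x = 0) →
      ∫ x in Ω t, inner ℝ (ρ (x, t) • MovingFluid.materialDeriv v v (x, t)) (z x) = 0) :
    ∃ σ : MovingFluid.Space → ℝ, ContDiffOn ℝ 1 σ (Ω t) ∧
      ∀ x ∈ Ω t, HasGradientAt σ (ρ (x, t) • MovingFluid.materialDeriv v v (x, t)) x := by
  have hslice : ∀ x ∈ Ω t, (x, t) ∈ MovingFluid.spaceTime T Ω := fun x hx => ⟨ht0, htT, hx⟩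
  refine MovingFluid.exists_potential (hΩ t ht0.le htT).isOpen (hΩ t ht0.le htT).isConnected
    (fun x hx => ?_) horth
  have hmk : ContinuousAt (fun y : MovingFluid.Space => (y, t)) x := by fun_prop
  have hvx := hv _ (hslice x hx)
  exact ((ContinuousAt.comp (f := fun y : MovingFluid.Space => (y, t))
    (hρ _ (hslice x hx)).continuousAt hmk).smul
    (ContinuousAt.comp (f := fun y : MovingFluid.Space => (y, t))
      (MovingFluid.continuousAt_materialDeriv hvx.continuousAt hvx) hmk)).continuousWithinAt
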